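/- Let $\varepsilon$ be a measurable field of real symmetric $3\times 3$ matrices on $\mathbb{R}^3$ with bounded entries that is uniformly elliptic, i.e. there is $c>0$ with $\xi\cdot\varepsilon(x)\xi\ge c|\xi|^2$ for almost every $x\in\mathbb{R}^3$ and all $\xi\in\mathbb{R}^3$, and suppose that $\varepsilon-I$ has compact support. Let $\varphi^{\mathrm{in}}$ be a (real- or complex-valued) function that is harmonic in a neighbourhood of the support of $\varepsilon-I$. Then the anisotropic electrostatic scattering problem has at most one solution: up to equality almost everywhere, there is at most one function $\varphi^{\mathrm{sc}}\in H^1_{\mathrm{loc}}(\mathbb{R}^3)$ that satisfies $$\nabla\cdot\varepsilon\nabla\varphi^{\mathrm{sc}}=-\nabla\cdot(\varepsilon-I)\nabla\varphi^{\mathrm{in}}\quad\text{in }\mathbb{R}^3$$ in the weak sense, i.e. $$\int_{\mathbb{R}^3}\nabla\psi\cdot\varepsilon\nabla\varphi^{\mathrm{sc}}\,dx=-\int_{\mathbb{R}^3}\nabla\psi\cdot(\varepsilon-I)\nabla\varphi^{\mathrm{in}}\,dx\quad\text{for all }\psi\in C_c^\infty(\mathbb{R}^3),$$ and the decay condition $\varphi^{\mathrm{sc}}(x)=o(1)$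 as $|x|\to\infty$, i.e. for every $\delta>0$ there is $R>0$ with $|\varphi^{\mathrm{sc}}(x)|<\delta$ for almost every $x$ with $|x|>R$. -/

import Mathlib

open MeasureTheory Filter Topology Matrix
open scoped ContDiff

namespace Electrostatic

/-- Physical space `ℝ³` with its Euclidean norm and Lebesgue measure. -/
abbrev Space : Type := EuclideanSpace ℝ (Fin 3)

/-- The classical partial derivative `∂ᵢ f (x)`. -/
noncomputable def partialDeriv {F : Type*} [NormedAddCommGroup F] [NormedSpace ℝ F]
    (i : Fin 3) (f : Space → F) (x : Space) : F :=
  fderiv ℝ f x (EuclideanSpace.single i (1 : ℝ))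

/-- Test functions: real-valued, smooth, compactly supported functions on `ℝ³`. -/
structure IsTestFunction (ψ : Space → ℝ) : Prop where
  smooth : ContDiff ℝ ∞ ψ
  compactSupport : HasCompactSupport ψ

/-- `f ∈ L²_loc(ℝ³)`. -/
def MemL2Loc {𝕜 : Type*} [RCLike 𝕜] (f : Space → 𝕜) : Prop :=
  ∀ K : Set Space, IsCompact K → MemLp f 2 (volume.restrict K)

/-- `f ∈ H¹_loc(ℝ³)` with weak gradient `g`: the function `f` and the components `gᵢ` lie in
`L²_loc(ℝ³)`, and `∫ (∂ᵢψ) f = - ∫ ψ gᵢ` for all test functions `ψ`. The weak gradient is unique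
up to equality almost everywhere. -/
structure MemH1LocWithGradient {𝕜 : Type*} [RCLike 𝕜]
    (f : Space → 𝕜) (g : Space → Fin 3 → 𝕜) : Prop where
  memL2Loc : MemL2Loc f
  gradient_memL2Loc : ∀ i, MemL2Loc (fun x => g x i)
  integral_by_parts : ∀ ψ : Space → ℝ, IsTestFunction ψ → ∀ i : Fin 3,
    ∫ x, partialDeriv i ψ x • f x = - ∫ x, ψ x • g x i

/-- The pairing `∫ ∇ψ · A G` over `ℝ³` of a real scalar function `ψ` with the vector field `A G`,
where `A` is a real matrix field and `G` a vector field. -/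
noncomputable def gradientPairing {𝕜 : Type*} [RCLike 𝕜] (A : Space → Matrix (Fin 3) (Fin 3) ℝ)
    (ψ : Space → ℝ) (G : Space → Fin 3 → 𝕜) : 𝕜 :=
  ∫ x, ∑ i, ∑ j, (partialDeriv i ψ x * A x i j) • G x j

/-- The standing assumptions on the coefficient `ε`: a measurable real symmetric matrix field with
bounded entries, uniformly positive definite (its smallest eigenvalue is bounded away from zero),
and such that `ε - I` has compact support. -/
structure IsAdmissibleCoefficient (ε : Space → Matrix (Fin 3) (Fin 3) ℝ) : Prop where
  aemeasurable : ∀ i j, AEMeasurable (fun x => ε x i j) volume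
  symmetric : ∀ᵐ x ∂(volume : Measure Space), (ε x).IsSymm
  bounded : ∃ M : ℝ, ∀ᵐ x ∂(volume : Measure Space), ∀ i j, |ε x i j| ≤ M
  elliptic : ∃ c : ℝ, 0 < c ∧ ∀ᵐ x ∂(volume : Measure Space), ∀ ξ : Fin 3 → ℝ,
    c * (ξ ⬝ᵥ ξ) ≤ ξ ⬝ᵥ (ε x *ᵥ ξ)
  compactSupport : HasCompactSupport (fun x => ε x - 1)

/-- The incoming field `φin` is harmonic on (a neighbourhood of) the support of `ε - I`.
Its values elsewhere are irrelevant. -/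
def IsIncomingField {𝕜 : Type*} [RCLike 𝕜] (ε : Space → Matrix (Fin 3) (Fin 3) ℝ)
    (φin : Space → 𝕜) : Prop :=
  InnerProductSpace.HarmonicOnNhd φin (tsupport (fun x => ε x - 1))

/-- `f = o(1)` at infinity, for a function that is defined up to null sets: for each `δ > 0`,
`‖f x‖ < δ` for almost all `x` outside some compact set. -/
def VanishesAtInfinity {𝕜 : Type*} [RCLike 𝕜] (f : Space → 𝕜) : Prop :=
  Tendsto f (cocompact Space ⊓ ae volume) (𝓝 0)

/-- `φ` solves the anisotropic electrostatic scattering problem with coefficient `ε` and incoming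
field `φin`: `φ ∈ H¹_loc(ℝ³)`, `∇·ε∇φ = -∇·(ε - I)∇φin` on `ℝ³` in the weak sense, that is
`∫ ∇ψ · ε∇φ = - ∫ ∇ψ · (ε - I)∇φin` for all test functions `ψ`, and `φ = o(1)` at infinity. -/
def IsScatteringSolution {𝕜 : Type*} [RCLike 𝕜] (ε : Space → Matrix (Fin 3) (Fin 3) ℝ)
    (φin φ : Space → 𝕜) : Prop :=
  (∃ g : Space → Fin 3 → 𝕜, MemH1LocWithGradient φ g ∧
    ∀ ψ : Space → ℝ, IsTestFunction ψ →
      gradientPairing ε ψ g =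
        - gradientPairing (fun x => ε x - 1) ψ (fun x j => partialDeriv j φin x)) ∧
  VanishesAtInfinity φ

end Electrostatic

/-!
Uniqueness for the scattering problem is a weak maximum principle, and needs no more information on
the behaviour at infinity than `φ = o(1)`.

The difference `f` of two solutions lies in `H¹_loc`, solves `∇·ε∇f = 0` weakly and vanishes at
infinity; composing with real-linear functionals, it may be taken real-valued. Fix `δ > 0`, and let
`F` be a smooth bounded nondecreasing function with `F t = 0` exactly for `t ≤ δ`, a smooth
substitute for `t ↦ (t - δ)⁺` (`exists_smooth_truncation`). As `f ≤ δ` outside some ball, `F ∘ f`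
is compactly supported, and testing the equation with it gives `∫ F'(f) ∇f · ε∇f = 0`. By
ellipticity `F'(f) ∇f = 0`, which is the gradient of `F ∘ f`; hence `F ∘ f = 0` by Poincaré's
inequality, that is, `f ≤ δ` (`ae_le_of_ae_le_near_infinity`). Apply this to `f` and `-f` and let
`δ → 0`.

Only smooth test functions are available, so `F ∘ (ρₙ ⋆ f)` is used in place of `F ∘ f`, with
mollifiers `ρₙ` supported in the unit ball. These functions are supported in one fixed ball, and
their gradients `F'(ρₙ ⋆ f) (ρₙ ⋆ ∇f)` (`MemH1LocWithGradient.partialDeriv_mollify`) converge to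
`F'(f) ∇f` in `L²`: the first factor is bounded and converges almost everywhere, and the second
converges in `L²_loc` (`tendsto_eLpNorm_mollify_sub`), because mollification is a contraction of
`L²` and converges uniformly for continuous functions of compact support.
-/

namespace Electrostatic

/-! ### Mollification in `L²` -/

section Mollification

open scoped Convolution

variable {E F : Type*} [NormedAddCommGroup E] [NormedSpace ℝ E] [MeasurableSpace E]
  [HasContDiffBump E] [NormedAddCommGroup F] [NormedSpace ℝ F] {μ : Measure E}

/-- The mollification `ρ ⋆ f` of `f` with the normalised bump function `ρ` attached to `φ`. -/
noncomputable def mollify (μ : Measure E) (φ : ContDiffBump (0 : E)) (f : E → F) : E → F :=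
  φ.normed μ ⋆[ContinuousLinearMap.lsmul ℝ ℝ, μ] f

theorem mollify_apply (φ : ContDiffBump (0 : E)) (f : E → F) (x : E) :
    mollify μ φ f x = ∫ t, φ.normed μ t • f (x - t) ∂μ := rfl

variable [FiniteDimensional ℝ E] [BorelSpace E] [μ.IsAddHaarMeasure]

theorem mollify_apply_swap (φ : ContDiffBump (0 : E)) (f : E → F) (x : E) :
    mollify μ φ f x = ∫ t, φ.normed μ (x - t) • f t ∂μ :=
  convolution_eq_swap _

theorem lintegral_enorm_normed (φ : ContDiffBump (0 : E)) :
    ∫⁻ t, ‖φ.normed μ t‖ₑ ∂μ = 1 := by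
  rw [← ofReal_integral_norm_eq_lintegral_enorm φ.integrable_normed]
  simp [Real.norm_of_nonneg (φ.nonneg_normed _), φ.integral_normed]

theorem contDiff_mollify (φ : ContDiffBump (0 : E)) {f : E → F}
    (hf : LocallyIntegrable f μ) : ContDiff ℝ ∞ (mollify μ φ f) :=
  φ.hasCompactSupport_normed.contDiff_convolution_left _ φ.contDiff_normed hf

theorem integrable_mollify_integrand (φ : ContDiffBump (0 : E)) {f : E → F}
    (hf : LocallyIntegrable f μ) (x : E) :
    Integrable (fun t => φ.normed μ t • f (x - t)) μ :=
  φ.hasCompactSupport_normed.convolutionExists_left (ContinuousLinearMap.lsmul ℝ ℝ)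
    φ.continuous_normed hf x

/-- The values of a mollification on `s` see only the values of `f` on the `φ.rOut`-neighbourhood
of `s`. -/
theorem mollify_congr_of_ball (φ : ContDiffBump (0 : E)) {f g : E → F} {x : E}
    (h : ∀ᵐ y ∂μ, y ∈ Metric.ball x φ.rOut → f y = g y) :
    mollify μ φ f x = mollify μ φ g x := by
  rw [mollify_apply_swap, mollify_apply_swap]
  refine integral_congr_ae ?_
  filter_upwards [h] with y hy
  by_cases hm : y ∈ Metric.ball x φ.rOut
  · simp only [hy hm]
  · have : φ.normed μ (x - y) = 0 := by
      rw [← Function.notMem_support, φ.support_normed_eq]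
      simpa [dist_eq_norm, norm_sub_rev] using hm
    simp [this]

theorem mollify_le_of_ball (φ : ContDiffBump (0 : E)) {f : E → ℝ} {x : E} {c : ℝ}
    (hf : LocallyIntegrable f μ) (h : ∀ᵐ y ∂μ, y ∈ Metric.ball x φ.rOut → f y ≤ c) :
    mollify μ φ f x ≤ c := by
  have key : mollify μ φ f x ≤ ∫ t, φ.normed μ t * c ∂μ := by
    rw [mollify_apply]
    refine integral_mono_ae (integrable_mollify_integrand φ hf x)
      (φ.integrable_normed.mul_const c) ?_
    filter_upwards [(Measure.measurePreserving_sub_left μ x).quasiMeasurePreserving.ae h] with t ht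
    by_cases hm : t ∈ Metric.ball (0 : E) φ.rOut
    · exact mul_le_mul_of_nonneg_left (ht (by simpa [dist_eq_norm] using hm)) (φ.nonneg_normed _)
    · have : φ.normed μ t = 0 := by
        rw [← Function.notMem_support, φ.support_normed_eq]; exact hm
      simp [this]
  rwa [integral_mul_const, φ.integral_normed, one_mul] at key

/-- Jensen's inequality and Tonelli's theorem: mollification is a contraction of `L²`. -/
theorem eLpNorm_mollify_le (φ : ContDiffBump (0 : E)) {f : E → F}
    (hf : AEStronglyMeasurable f μ) :
    eLpNorm (mollify μ φ f) 2 μ ≤ eLpNorm f 2 μ := by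
  wlog hm : StronglyMeasurable f generalizing f
  · obtain ⟨f', hf', hff'⟩ := hf
    have h := this hf'.aestronglyMeasurable hf'
    have h1 : mollify μ φ f = mollify μ φ f' := by
      funext x
      exact mollify_congr_of_ball φ (hff'.mono fun y hy _ => hy)
    rwa [h1, eLpNorm_congr_ae hff']
  have hρ : Measurable fun t => ‖φ.normed μ t‖ₑ := φ.continuous_normed.enorm.measurable
  have hF : Measurable fun p : E × E => ‖f (p.1 - p.2)‖ₑ :=
    hm.enorm.comp (measurable_fst.sub measurable_snd)
  have hpt : ∀ x, ‖mollify μ φ f x‖ₑ ^ 2 ≤ ∫⁻ t, ‖φ.normed μ t‖ₑ * ‖f (x - t)‖ₑ ^ 2 ∂μ := by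
    intro x
    have hFx : Measurable fun t => ‖f (x - t)‖ₑ := hF.comp measurable_prodMk_left
    -- Cauchy–Schwarz for `ρ |f| = √ρ · √(ρ |f|²)`, where `ρ` has mass one
    have h1 : ‖mollify μ φ f x‖ₑ ≤
        (∫⁻ t, ‖φ.normed μ t‖ₑ * ‖f (x - t)‖ₑ ^ 2 ∂μ) ^ (1 / 2 : ℝ) := by
      calc ‖mollify μ φ f x‖ₑ ≤ ∫⁻ t, ‖φ.normed μ t • f (x - t)‖ₑ ∂μ := by
            rw [mollify_apply]; exact enorm_integral_le_lintegral_enorm _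
        _ = ∫⁻ t, ‖φ.normed μ t‖ₑ ^ (1 / 2 : ℝ) *
              (‖φ.normed μ t‖ₑ * ‖f (x - t)‖ₑ ^ 2) ^ (1 / 2 : ℝ) ∂μ := by
            refine lintegral_congr fun t => ?_
            rw [enorm_smul, ENNReal.mul_rpow_of_nonneg _ _ (by norm_num), ← mul_assoc,
              ← ENNReal.rpow_add_of_nonneg _ _ (by norm_num) (by norm_num),
              ← ENNReal.rpow_natCast, ← ENNReal.rpow_mul]
            norm_num
        _ ≤ (∫⁻ t, ‖φ.normed μ t‖ₑ ∂μ) ^ (1 / 2 : ℝ) *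
              (∫⁻ t, ‖φ.normed μ t‖ₑ * ‖f (x - t)‖ₑ ^ 2 ∂μ) ^ (1 / 2 : ℝ) :=
            ENNReal.lintegral_mul_norm_pow_le hρ.aemeasurable
              (hρ.mul (hFx.pow_const 2)).aemeasurable (by norm_num) (by norm_num) (by norm_num)
        _ = _ := by rw [lintegral_enorm_normed, ENNReal.one_rpow, one_mul]
    calc ‖mollify μ φ f x‖ₑ ^ 2
        ≤ ((∫⁻ t, ‖φ.normed μ t‖ₑ * ‖f (x - t)‖ₑ ^ 2 ∂μ) ^ (1 / 2 : ℝ)) ^ 2 := by gcongr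
      _ = _ := by
        rw [← ENNReal.rpow_natCast, ← ENNReal.rpow_mul]
        norm_num
  rw [eLpNorm_eq_lintegral_rpow_enorm_toReal (by norm_num) (by norm_num),
    eLpNorm_eq_lintegral_rpow_enorm_toReal (by norm_num) (by norm_num)]
  gcongr ?_ ^ _
  simp only [ENNReal.toReal_ofNat, ENNReal.rpow_ofNat]
  calc ∫⁻ x, ‖mollify μ φ f x‖ₑ ^ 2 ∂μ
      ≤ ∫⁻ x, ∫⁻ t, ‖φ.normed μ t‖ₑ * ‖f (x - t)‖ₑ ^ 2 ∂μ ∂μ := lintegral_mono hpt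
    _ = ∫⁻ t, ∫⁻ x, ‖φ.normed μ t‖ₑ * ‖f (x - t)‖ₑ ^ 2 ∂μ ∂μ :=
        lintegral_lintegral_swap ((hρ.comp measurable_snd).mul (hF.pow_const 2)).aemeasurable
    _ = ∫⁻ t, ‖φ.normed μ t‖ₑ * ∫⁻ x, ‖f x‖ₑ ^ 2 ∂μ ∂μ := by
        refine lintegral_congr fun t => ?_
        have hFt : Measurable fun x => ‖f (x - t)‖ₑ := hF.comp measurable_prodMk_right
        rw [lintegral_const_mul _ (hFt.pow_const 2),
          lintegral_sub_right_eq_self (fun x => ‖f x‖ₑ ^ 2) t]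
    _ = ∫⁻ x, ‖f x‖ₑ ^ 2 ∂μ := by
        rw [lintegral_mul_const _ hρ, lintegral_enorm_normed, one_mul]

/-- By density of continuous functions of compact support, on which the convergence is uniform. -/
theorem tendsto_eLpNorm_mollify_sub_of_memLp [CompleteSpace F] {φ : ℕ → ContDiffBump (0 : E)}
    (hφ : Tendsto (fun n => (φ n).rOut) atTop (𝓝 0)) {f : E → F} (hf : MemLp f 2 μ)
    {K : Set E} (hK : IsCompact K) :
    Tendsto (fun n => eLpNorm (mollify μ (φ n) f - f) 2 (μ.restrict K)) atTop (𝓝 0) := by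
  rw [ENNReal.tendsto_nhds_zero]
  intro η hη
  obtain ⟨ε', hε'0, hε'⟩ : ∃ ε' : ENNReal, ε' ≠ 0 ∧ ε' + ε' + ε' ≤ η := by
    refine ⟨η / 3, (ENNReal.div_pos hη.ne' (by norm_num)).ne', ?_⟩
    rw [ENNReal.add_thirds]
  obtain ⟨h, hhc, hfh, hcont, hhL⟩ := hf.exists_hasCompactSupport_eLpNorm_sub_le (by norm_num) hε'0
  -- the mollifications of the continuous function `h` converge uniformly
  have hμK : μ K ^ (2 : ENNReal).toReal⁻¹ ≠ ⊤ :=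
    ENNReal.rpow_ne_top_of_nonneg (by norm_num) hK.measure_lt_top.ne
  obtain ⟨d, hd0, hd⟩ : ∃ d : ℝ, 0 < d ∧
      μ K ^ (2 : ENNReal).toReal⁻¹ * ENNReal.ofReal d ≤ ε' := by
    have : Tendsto (fun d : ℝ => μ K ^ (2 : ENNReal).toReal⁻¹ * ENNReal.ofReal d)
        (𝓝[>] 0) (𝓝 (μ K ^ (2 : ENNReal).toReal⁻¹ * ENNReal.ofReal 0)) :=
      (ENNReal.Tendsto.const_mul (ENNReal.tendsto_ofReal tendsto_id) (Or.inr hμK)).mono_left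
        nhdsWithin_le_nhds
    rw [ENNReal.ofReal_zero, mul_zero] at this
    obtain ⟨d, hd1, hd2⟩ := ((ENNReal.tendsto_nhds_zero.1 this ε' (pos_iff_ne_zero.2 hε'0)).and
      self_mem_nhdsWithin).exists
    exact ⟨d, hd2, hd1⟩
  obtain ⟨r, hr0, hr⟩ := Metric.uniformContinuous_iff.1
    (hhc.uniformContinuous_of_continuous hcont) d hd0
  filter_upwards [hφ.eventually (gt_mem_nhds hr0)] with n hn
  have hfm := hf.1
  have hmeas : ∀ {u : E → F}, MemLp u 2 μ → AEStronglyMeasurable (mollify μ (φ n) u) μ :=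
    fun hu =>
      (contDiff_mollify (φ n) (hu.locallyIntegrable (by norm_num))).continuous.aestronglyMeasurable
  have hsplit : mollify μ (φ n) f - f =
      (mollify μ (φ n) (f - h) + (mollify μ (φ n) h - h)) + (h - f) := by
    funext x
    have : mollify μ (φ n) (f - h) x = mollify μ (φ n) f x - mollify μ (φ n) h x := by
      simp only [mollify_apply, Pi.sub_apply, smul_sub]
      exact integral_sub (integrable_mollify_integrand _ (hf.locallyIntegrable (by norm_num)) x)
        (integrable_mollify_integrand _ (hhL.locallyIntegrable (by norm_num)) x)
    simp only [Pi.add_apply, Pi.sub_apply, this]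
    abel
  have h1 : eLpNorm (mollify μ (φ n) (f - h)) 2 (μ.restrict K) ≤ ε' :=
    (eLpNorm_mono_measure _ Measure.restrict_le_self).trans
      ((eLpNorm_mollify_le (φ n) (hf.sub hhL).1).trans hfh)
  have h2 : eLpNorm (mollify μ (φ n) h - h) 2 (μ.restrict K) ≤ ε' := by
    refine (eLpNorm_le_of_ae_bound (C := d) (ae_of_all _ fun x => ?_)).trans (by simpa using hd)
    rw [Pi.sub_apply, ← dist_eq_norm]
    refine ContDiffBump.dist_normed_convolution_le hcont.aestronglyMeasurable fun y hy => ?_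
    exact (hr ((Metric.mem_ball.1 hy).trans hn)).le
  have h3 : eLpNorm (h - f) 2 (μ.restrict K) ≤ ε' := by
    rw [eLpNorm_sub_comm]
    exact (eLpNorm_mono_measure _ Measure.restrict_le_self).trans hfh
  rw [hsplit]
  have m1 := (hmeas (hf.sub hhL)).restrict (s := K)
  have m2 := ((hmeas hhL).sub hhL.1).restrict (s := K)
  calc _ ≤ _ := eLpNorm_add_le (m1.add m2) (hhL.1.sub hfm).restrict (by norm_num)
    _ ≤ _ := add_le_add_left (eLpNorm_add_le m1 m2 (by norm_num)) _
    _ ≤ ε' + ε' + ε' := by gcongr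
    _ ≤ η := hε'

/-- Local version of the convergence of mollifications in `L²`: near a compact set, `f` may be
replaced by a global `L²` function. -/
theorem tendsto_eLpNorm_mollify_sub [CompleteSpace F] {φ : ℕ → ContDiffBump (0 : E)}
    (hφ : Tendsto (fun n => (φ n).rOut) atTop (𝓝 0)) {f : E → F}
    (hf : ∀ K : Set E, IsCompact K → MemLp f 2 (μ.restrict K)) {K : Set E} (hK : IsCompact K) :
    Tendsto (fun n => eLpNorm (mollify μ (φ n) f - f) 2 (μ.restrict K)) atTop (𝓝 0) := by
  have hT : IsCompact (Metric.cthickening 1 K) := hK.cthickening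
  have hf' : MemLp ((Metric.cthickening 1 K).indicator f) 2 μ :=
    (memLp_indicator_iff_restrict hT.measurableSet).2 (hf _ hT)
  refine (tendsto_eLpNorm_mollify_sub_of_memLp hφ hf' hK).congr' ?_
  filter_upwards [hφ.eventually (gt_mem_nhds one_pos)] with n hn
  refine eLpNorm_congr_ae ((ae_restrict_iff' hK.measurableSet).2 (ae_of_all _ fun x hx => ?_))
  have hmem : ∀ y ∈ Metric.ball x (φ n).rOut, y ∈ Metric.cthickening 1 K := fun y hy =>
    Metric.mem_cthickening_of_dist_le y x 1 K hx ((Metric.mem_ball.1 hy).trans hn).le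
  simp only [Pi.sub_apply]
  rw [Set.indicator_of_mem (hmem x (Metric.mem_ball_self (φ n).rOut_pos)),
    mollify_congr_of_ball (φ n) (ae_of_all _ fun y hy => Set.indicator_of_mem (hmem y hy) f)]

end Mollification

/-! ### Products and limits in `L²` -/

section LpLimits

variable {α : Type*} {m : MeasurableSpace α} {ν : Measure α}

/-- If `Dₙ → d` almost everywhere and boundedly, and `aₙ → g` in `L²`, then `Dₙ aₙ → d g` in `L²`:
split `Dₙ aₙ - d g = Dₙ (aₙ - g) + (Dₙ - d) g` and use dominated convergence in the second term. -/
theorem tendsto_eLpNorm_mul_sub {D : ℕ → α → ℝ} {d : α → ℝ} {a : ℕ → α → ℝ} {g : α → ℝ} {M : ℝ}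
    (hD : ∀ n, AEStronglyMeasurable (D n) ν) (hDM : ∀ n x, |D n x| ≤ M)
    (hd : AEStronglyMeasurable d ν)
    (hDd : ∀ᵐ x ∂ν, Tendsto (fun n => D n x) atTop (𝓝 (d x)))
    (ha : ∀ n, AEStronglyMeasurable (a n) ν) (hg : MemLp g 2 ν)
    (hag : Tendsto (fun n => eLpNorm (a n - g) 2 ν) atTop (𝓝 0)) :
    Tendsto (fun n => eLpNorm (D n * a n - d * g) 2 ν) atTop (𝓝 0) := by
  have h1 : Tendsto (fun n => eLpNorm (D n * (a n - g)) 2 ν) atTop (𝓝 0) := by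
    have hM : Tendsto (fun n => ENNReal.ofReal M * eLpNorm (a n - g) 2 ν) atTop (𝓝 0) := by
      simpa using ENNReal.Tendsto.const_mul hag (Or.inr ENNReal.ofReal_ne_top)
    refine tendsto_of_tendsto_of_tendsto_of_le_of_le tendsto_const_nhds hM (fun _ => zero_le)
      fun n => eLpNorm_le_mul_eLpNorm_of_ae_le_mul (ae_of_all _ fun x => ?_) 2
    rw [Pi.mul_apply, norm_mul]
    exact mul_le_mul_of_nonneg_right (hDM n x) (norm_nonneg _)
  have h2 : Tendsto (fun n => eLpNorm ((D n - d) * g) 2 ν) atTop (𝓝 0) := by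
    simp only [eLpNorm_eq_lintegral_rpow_enorm_toReal (p := 2) (by norm_num) (by norm_num)]
    have hlim : Tendsto (fun n => ∫⁻ x, ‖((D n - d) * g) x‖ₑ ^ (2 : ENNReal).toReal ∂ν) atTop
        (𝓝 (∫⁻ _, 0 ∂ν)) := by
      refine tendsto_lintegral_of_dominated_convergence'
        (fun x => (ENNReal.ofReal (2 * M) * ‖g x‖ₑ) ^ (2 : ENNReal).toReal)
        (fun n => ((((hD n).sub hd).mul hg.1).enorm.pow_const _)) (fun n => ?_) ?_ ?_
      · filter_upwards [hDd] with x hx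
        have hdM : |d x| ≤ M := le_of_tendsto hx.abs (Eventually.of_forall fun n => hDM n x)
        gcongr
        rw [Pi.mul_apply, enorm_mul]
        gcongr
        rw [Real.enorm_eq_ofReal_abs]
        refine ENNReal.ofReal_le_ofReal ((abs_sub _ _).trans ?_)
        linarith [hDM n x]
      · have h3 := (eLpNorm_lt_top_iff_lintegral_rpow_enorm_lt_top (p := 2) (by norm_num)
          (by norm_num)).1 hg.2
        simp only [ENNReal.mul_rpow_of_nonneg _ _ ENNReal.toReal_nonneg]
        rw [lintegral_const_mul' _ _ (ENNReal.rpow_ne_top_of_nonneg ENNReal.toReal_nonneg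
          ENNReal.ofReal_ne_top)]
        exact ENNReal.mul_ne_top (ENNReal.rpow_ne_top_of_nonneg ENNReal.toReal_nonneg
          ENNReal.ofReal_ne_top) h3.ne
      · filter_upwards [hDd] with x hx
        have h4 : Tendsto (fun n => ((D n - d) * g) x) atTop (𝓝 0) := by
          simpa using (hx.sub_const (d x)).mul_const (g x)
        have h5 := (h4.enorm).ennrpow_const (2 : ENNReal).toReal
        simpa using h5
    rw [lintegral_zero] at hlim
    simpa using hlim.ennrpow_const (1 / (2 : ENNReal).toReal)
  refine tendsto_of_tendsto_of_tendsto_of_le_of_le tendsto_const_nhds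
    (by simpa using h1.add h2) (fun _ => zero_le) fun n => ?_
  have : D n * a n - d * g = D n * (a n - g) + (D n - d) * g := by ring
  rw [this]
  exact eLpNorm_add_le ((hD n).mul ((ha n).sub hg.1)) (((hD n).sub hd).mul hg.1) (by norm_num)

theorem tendsto_integral_mul_of_tendsto_eLpNorm {u : ℕ → α → ℝ} {v w : α → ℝ}
    (hu : ∀ n, MemLp (u n) 2 ν) (hv : MemLp v 2 ν) (hw : MemLp w 2 ν)
    (huv : Tendsto (fun n => eLpNorm (u n - v) 2 ν) atTop (𝓝 0)) :
    Tendsto (fun n => ∫ x, u n x * w x ∂ν) atTop (𝓝 (∫ x, v x * w x ∂ν)) := by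
  refine tendsto_integral_of_L1' (F := fun n x => u n x * w x) (fun x => v x * w x)
    (hv.1.mul hw.1) (Eventually.of_forall fun n => (hu n).integrable_mul hw) ?_
  have hlim : Tendsto (fun n => eLpNorm (u n - v) 2 ν * eLpNorm w 2 ν) atTop (𝓝 0) := by
    simpa using ENNReal.Tendsto.mul_const huv (Or.inr hw.2.ne)
  refine tendsto_of_tendsto_of_tendsto_of_le_of_le tendsto_const_nhds hlim (fun _ => zero_le)
    fun n => ?_
  have : ((fun x => u n x * w x) - fun x => v x * w x) = (u n - v) • w := by
    funext x
    simp [sub_mul]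
  simp only [this]
  exact eLpNorm_smul_le_mul_eLpNorm hw.1 ((hu n).1.sub hv.1)

theorem memLp_smul_of_ae_bounded {𝕜 : Type*} [RCLike 𝕜] {b : α → ℝ} {f : α → 𝕜}
    {p : ENNReal} {M : ℝ}
    (hf : MemLp f p ν) (hb : AEStronglyMeasurable b ν) (hbM : ∀ᵐ x ∂ν, |b x| ≤ M) :
    MemLp (fun x => b x • f x) p ν :=
  MemLp.of_le_mul (c := M) hf (hb.smul hf.1) (hbM.mono fun x hx => by
    rw [norm_smul]
    exact mul_le_mul_of_nonneg_right hx (norm_nonneg _))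

end LpLimits

/-! ### A smooth monotone truncation -/

/-- A smooth substitute `F` for the positive part `t ↦ (t - δ)⁺`. -/
theorem exists_smooth_truncation (δ : ℝ) :
    ∃ F : ℝ → ℝ, ContDiff ℝ ∞ F ∧ (∀ t, F t = 0 ↔ t ≤ δ) ∧ (∀ t, 0 ≤ deriv F t) ∧
      (∀ t ≤ δ, deriv F t = 0) ∧ ∃ M, ∀ t, |deriv F t| ≤ M := by
  have hS : ContDiff ℝ ∞ Real.smoothTransition := Real.smoothTransition.contDiff
  have hderiv : ∀ t, deriv (fun t => Real.smoothTransition (t - δ)) t =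
      deriv Real.smoothTransition (t - δ) := fun t => deriv_comp_sub_const _ _ _
  have h0 : ∀ t ≤ 0, deriv Real.smoothTransition t = 0 := fun t ht =>
    IsLocalMin.deriv_eq_zero (Eventually.of_forall fun s => by
      rw [Real.smoothTransition.zero_of_nonpos ht]
      exact Real.smoothTransition.nonneg s)
  have h1 : ∀ t, 1 ≤ t → deriv Real.smoothTransition t = 0 := fun t ht =>
    IsLocalMax.deriv_eq_zero (Eventually.of_forall fun s => by
      rw [Real.smoothTransition.one_of_one_le ht]
      exact Real.smoothTransition.le_one s)
  refine ⟨fun t => Real.smoothTransition (t - δ), hS.comp (contDiff_id.sub contDiff_const),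
    fun t => by rw [Real.smoothTransition.zero_iff_nonpos, sub_nonpos], fun t => ?_, fun t ht => ?_,
    ?_⟩
  · rw [hderiv]
    exact Real.smoothTransition.monotone.deriv_nonneg
  · rw [hderiv]
    exact h0 _ (by linarith)
  · have hsupp : HasCompactSupport (deriv Real.smoothTransition) := by
      refine HasCompactSupport.of_support_subset_isCompact (isCompact_Icc (a := (0 : ℝ)) (b := 1))
        fun t ht => ?_
      by_contra hmem
      rw [Set.mem_Icc, not_and_or, not_le, not_le] at hmem
      exact ht (hmem.elim (fun h => h0 t h.le) fun h => h1 t h.le)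
    obtain ⟨M, hM⟩ := hsupp.exists_bound_of_continuous (hS.continuous_deriv (by simp))
    exact ⟨M, fun t => by rw [hderiv]; exact hM _⟩

/-! ### Functions in `H¹_loc` and their weak gradients -/

section WeakGradient

variable {𝕜 : Type*} [RCLike 𝕜]

theorem MemL2Loc.locallyIntegrable {f : Space → 𝕜} (hf : MemL2Loc f) :
    LocallyIntegrable f volume := by
  refine locallyIntegrable_iff.2 fun K hK => ?_
  have : IsFiniteMeasure (volume.restrict K) := ⟨by simpa using hK.measure_lt_top⟩
  exact (hf K hK).integrable (by norm_num)

theorem MemL2Loc.sub {f g : Space → 𝕜} (hf : MemL2Loc f) (hg : MemL2Loc g) :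
    MemL2Loc (fun x => f x - g x) :=
  fun K hK => (hf K hK).sub (hg K hK)

theorem MemL2Loc.clm_comp {𝕜' : Type*} [RCLike 𝕜'] (L : 𝕜 →L[ℝ] 𝕜') {f : Space → 𝕜}
    (hf : MemL2Loc f) : MemL2Loc (fun x => L (f x)) :=
  fun K hK => L.comp_memLp' (hf K hK)

theorem IsTestFunction.continuous_partialDeriv {ψ : Space → ℝ} (hψ : IsTestFunction ψ)
    (i : Fin 3) : Continuous (partialDeriv i ψ) :=
  (hψ.smooth.continuous_fderiv (by simp)).clm_apply continuous_const

theorem IsTestFunction.hasCompactSupport_partialDeriv {ψ : Space → ℝ} (hψ : IsTestFunction ψ)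
    (i : Fin 3) : HasCompactSupport (partialDeriv i ψ) :=
  hψ.compactSupport.fderiv_apply ℝ _

theorem MemL2Loc.integrable_smul {ρ : Space → ℝ} {f : Space → 𝕜} (hf : MemL2Loc f)
    (hρ : Continuous ρ) (hc : HasCompactSupport ρ) : Integrable (fun x => ρ x • f x) volume :=
  hf.locallyIntegrable.integrable_smul_left_of_hasCompactSupport hρ hc

theorem MemH1LocWithGradient.sub {f₁ f₂ : Space → 𝕜} {g₁ g₂ : Space → Fin 3 → 𝕜}
    (h₁ : MemH1LocWithGradient f₁ g₁) (h₂ : MemH1LocWithGradient f₂ g₂) :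
    MemH1LocWithGradient (fun x => f₁ x - f₂ x) (fun x j => g₁ x j - g₂ x j) where
  memL2Loc := h₁.memL2Loc.sub h₂.memL2Loc
  gradient_memL2Loc i := (h₁.gradient_memL2Loc i).sub (h₂.gradient_memL2Loc i)
  integral_by_parts ψ hψ i := by
    have hc := hψ.continuous_partialDeriv i
    have hs := hψ.hasCompactSupport_partialDeriv i
    have hc' := hψ.smooth.continuous
    simp only [smul_sub]
    rw [integral_sub (h₁.memL2Loc.integrable_smul hc hs) (h₂.memL2Loc.integrable_smul hc hs),
      integral_sub ((h₁.gradient_memL2Loc i).integrable_smul hc' hψ.compactSupport)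
        ((h₂.gradient_memL2Loc i).integrable_smul hc' hψ.compactSupport),
      h₁.integral_by_parts ψ hψ i, h₂.integral_by_parts ψ hψ i]
    abel

theorem MemH1LocWithGradient.clm_comp {𝕜' : Type*} [RCLike 𝕜'] (L : 𝕜 →L[ℝ] 𝕜')
    {f : Space → 𝕜} {g : Space → Fin 3 → 𝕜} (h : MemH1LocWithGradient f g) :
    MemH1LocWithGradient (fun x => L (f x)) (fun x j => L (g x j)) where
  memL2Loc := h.memL2Loc.clm_comp L
  gradient_memL2Loc i := (h.gradient_memL2Loc i).clm_comp L
  integral_by_parts ψ hψ i := by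
    simp only [← L.map_smul]
    rw [L.integral_comp_comm (h.memL2Loc.integrable_smul (hψ.continuous_partialDeriv i)
        (hψ.hasCompactSupport_partialDeriv i)),
      L.integral_comp_comm ((h.gradient_memL2Loc i).integrable_smul hψ.smooth.continuous
        hψ.compactSupport), h.integral_by_parts ψ hψ i, map_neg]

/-- Mollification commutes with differentiation: integrate by parts against
`y ↦ ρ (x - y)`. -/
theorem MemH1LocWithGradient.partialDeriv_mollify {f : Space → ℝ} {g : Space → Fin 3 → ℝ}
    (h : MemH1LocWithGradient f g) (φ : ContDiffBump (0 : Space)) (i : Fin 3) (x : Space) :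
    partialDeriv i (mollify volume φ f) x = mollify volume φ (fun y => g y i) x := by
  have hρc : HasCompactSupport (φ.normed (volume : Measure Space)) := φ.hasCompactSupport_normed
  have hρs : ContDiff ℝ ∞ (φ.normed (volume : Measure Space)) := φ.contDiff_normed
  have hρ1 : ContDiff ℝ 1 (φ.normed (volume : Measure Space)) := φ.contDiff_normed
  have hf := h.memL2Loc.locallyIntegrable
  have hfd := hρc.hasFDerivAt_convolution_left (ContinuousLinearMap.lsmul ℝ ℝ) hρ1 hf x
  have hex := (hρc.fderiv ℝ).convolutionExists_left
    ((ContinuousLinearMap.lsmul ℝ ℝ).precompL Space) (hρ1.continuous_fderiv (by simp)) hf x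
  have hψ : IsTestFunction (fun y => φ.normed volume (x - y)) :=
    ⟨hρs.comp (contDiff_const.sub contDiff_id),
      hρc.comp_homeomorph (Homeomorph.subLeft x)⟩
  have hpd : ∀ y, partialDeriv i (fun y => φ.normed volume (x - y)) y =
      -(fderiv ℝ (φ.normed volume) (x - y) (EuclideanSpace.single i (1 : ℝ))) := by
    intro y
    have hd := (hρ1.differentiable one_ne_zero (x - y)).hasFDerivAt.comp y
      ((hasFDerivAt_id y).const_sub x)
    rw [partialDeriv, show fderiv ℝ (fun y => φ.normed volume (x - y)) y = _ from hd.fderiv]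
    simp
  have h1 := h.integral_by_parts _ hψ i
  unfold partialDeriv at hpd ⊢
  rw [show fderiv ℝ (mollify volume φ f) x = _ from hfd.fderiv, mollify_apply_swap,
    convolution_def, ContinuousLinearMap.integral_apply hex]
  simp only [ContinuousLinearMap.precompL_apply]
  rw [← integral_sub_left_eq_self _ volume x]
  simp only [sub_sub_cancel, ContinuousLinearMap.lsmul_apply]
  simp only [partialDeriv, hpd, neg_smul, integral_neg, neg_inj] at h1
  exact h1

end WeakGradient

/-! ### The weak form of `∇·ε∇φ` -/

section Pairing

variable {𝕜 : Type*} [RCLike 𝕜] {ε : Space → Matrix (Fin 3) (Fin 3) ℝ}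

theorem IsAdmissibleCoefficient.memL2Loc_smul (hε : IsAdmissibleCoefficient ε) {f : Space → 𝕜}
    (hf : MemL2Loc f) (i j : Fin 3) : MemL2Loc (fun x => ε x i j • f x) := by
  obtain ⟨M, hM⟩ := hε.bounded
  intro K hK
  exact memLp_smul_of_ae_bounded (hf K hK)
    (hε.aemeasurable i j).aestronglyMeasurable.restrict
    (ae_restrict_of_ae (hM.mono fun x hx => hx i j))

theorem IsAdmissibleCoefficient.integrable_pairing (hε : IsAdmissibleCoefficient ε)
    {G : Space → Fin 3 → 𝕜} (hG : ∀ i, MemL2Loc (fun x => G x i)) {ψ : Space → ℝ}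
    (hψ : IsTestFunction ψ) :
    Integrable (fun x => ∑ i, ∑ j, (partialDeriv i ψ x * ε x i j) • G x j) volume := by
  refine integrable_finsetSum _ fun i _ => integrable_finsetSum _ fun j _ => ?_
  simpa only [smul_smul] using (hε.memL2Loc_smul (hG j) i j).integrable_smul
    (hψ.continuous_partialDeriv i) (hψ.hasCompactSupport_partialDeriv i)

theorem IsAdmissibleCoefficient.gradientPairing_sub (hε : IsAdmissibleCoefficient ε)
    {G₁ G₂ : Space → Fin 3 → 𝕜} (h₁ : ∀ i, MemL2Loc (fun x => G₁ x i))
    (h₂ : ∀ i, MemL2Loc (fun x => G₂ x i)) {ψ : Space → ℝ} (hψ : IsTestFunction ψ) :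
    gradientPairing ε ψ (fun x j => G₁ x j - G₂ x j) =
      gradientPairing ε ψ G₁ - gradientPairing ε ψ G₂ := by
  unfold gradientPairing
  rw [← integral_sub (hε.integrable_pairing h₁ hψ) (hε.integrable_pairing h₂ hψ)]
  simp only [smul_sub, Finset.sum_sub_distrib]

theorem IsAdmissibleCoefficient.gradientPairing_clm_comp (hε : IsAdmissibleCoefficient ε)
    {𝕜' : Type*} [RCLike 𝕜'] (L : 𝕜 →L[ℝ] 𝕜') {G : Space → Fin 3 → 𝕜}
    (hG : ∀ i, MemL2Loc (fun x => G x i)) {ψ : Space → ℝ} (hψ : IsTestFunction ψ) :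
    gradientPairing ε ψ (fun x j => L (G x j)) = L (gradientPairing ε ψ G) := by
  unfold gradientPairing
  rw [← L.integral_comp_comm (hε.integrable_pairing hG hψ)]
  simp only [map_sum, map_smul]

end Pairing

/-! ### The weak maximum principle -/

theorem norm_fderiv_le_sum_partialDeriv (ψ : Space → ℝ) (x : Space) :
    ‖fderiv ℝ ψ x‖ ≤ ∑ i, ‖partialDeriv i ψ x‖ := by
  refine ContinuousLinearMap.opNorm_le_bound _ (by positivity) fun v => ?_
  have hv : v = ∑ i, v i • EuclideanSpace.single i (1 : ℝ) := by
    simpa using ((EuclideanSpace.basisFun (Fin 3) ℝ).sum_repr v).symm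
  calc ‖fderiv ℝ ψ x v‖ = ‖∑ i, v i * partialDeriv i ψ x‖ := by
        conv_lhs => rw [hv]
        simp [partialDeriv]
    _ ≤ ∑ i, ‖v i * partialDeriv i ψ x‖ := norm_sum_le _ _
    _ ≤ ∑ i, ‖v‖ * ‖partialDeriv i ψ x‖ := by
        gcongr with i
        rw [norm_mul]
        gcongr
        exact PiLp.norm_apply_le v i
    _ = (∑ i, ‖partialDeriv i ψ x‖) * ‖v‖ := by rw [← Finset.mul_sum, mul_comm]

/-- Poincaré's inequality on a bounded set, in qualitative form. -/
theorem tendsto_eLpNorm_of_tendsto_partialDeriv {ψ : ℕ → Space → ℝ} {s : Set Space}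
    (hψ : ∀ n, IsTestFunction (ψ n)) (hs : Bornology.IsBounded s)
    (hsupp : ∀ n, Function.support (ψ n) ⊆ s)
    (h : ∀ i, Tendsto (fun n => eLpNorm (partialDeriv i (ψ n)) 2 volume) atTop (𝓝 0)) :
    Tendsto (fun n => eLpNorm (ψ n) 2 volume) atTop (𝓝 0) := by
  have hsum : Tendsto (fun n => ∑ i, eLpNorm (partialDeriv i (ψ n)) 2 volume) atTop (𝓝 0) := by
    simpa using tendsto_finsetSum Finset.univ fun i _ => h i
  have hlim : Tendsto (fun n => (eLpNormLESNormFDerivOfLeConst ℝ (volume : Measure Space) s 2 2) *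
      ∑ i, eLpNorm (partialDeriv i (ψ n)) 2 volume) atTop (𝓝 0) := by
    simpa using ENNReal.Tendsto.const_mul hsum (Or.inr ENNReal.coe_ne_top)
  refine tendsto_of_tendsto_of_tendsto_of_le_of_le tendsto_const_nhds hlim (fun _ => zero_le)
    fun n => ?_
  have h1 := eLpNorm_le_eLpNorm_fderiv (volume : Measure Space) (p := 2)
    ((hψ n).smooth.of_le (by simp)) (hsupp n) (by norm_num) (by simp; norm_num) hs
  refine h1.trans ?_
  simp only [ENNReal.coe_ofNat]
  gcongr
  calc eLpNorm (fderiv ℝ (ψ n)) 2 volume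
      ≤ eLpNorm (∑ i, fun x => ‖partialDeriv i (ψ n) x‖) 2 volume :=
        eLpNorm_mono_real fun x => by
          simpa only [Finset.sum_apply] using norm_fderiv_le_sum_partialDeriv (ψ n) x
    _ ≤ ∑ i, eLpNorm (fun x => ‖partialDeriv i (ψ n) x‖) 2 volume :=
        eLpNorm_sum_le (fun i _ =>
          ((hψ n).continuous_partialDeriv i).norm.aestronglyMeasurable) (by norm_num)
    _ = ∑ i, eLpNorm (partialDeriv i (ψ n)) 2 volume := by simp only [eLpNorm_norm]

/-- Ellipticity: a vanishing weighted energy `∫ d g·εg` with weight `d ≥ 0` forces `d g = 0`. -/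
theorem IsAdmissibleCoefficient.ae_mul_eq_zero {ε : Space → Matrix (Fin 3) (Fin 3) ℝ}
    (hε : IsAdmissibleCoefficient ε) {ν : Measure Space} (hν : ν ≤ volume)
    {d : Space → ℝ} (hd : ∀ x, 0 ≤ d x) {g : Space → Fin 3 → ℝ}
    (hint : ∀ i, Integrable (fun x => d x * g x i * ∑ j, ε x i j * g x j) ν)
    (h0 : ∑ i, ∫ x, d x * g x i * ∑ j, ε x i j * g x j ∂ν = 0) :
    ∀ᵐ x ∂ν, ∀ i, d x * g x i = 0 := by
  obtain ⟨c, hc, hell⟩ := hε.elliptic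
  rw [← integral_finsetSum _ fun i _ => hint i] at h0
  have hform : ∀ x, ∑ i, d x * g x i * ∑ j, ε x i j * g x j = d x * (g x ⬝ᵥ (ε x *ᵥ g x)) := by
    intro x
    simp only [dotProduct, mulVec, Finset.mul_sum, mul_assoc]
  have hell' : ∀ᵐ x ∂ν, ∀ ξ : Fin 3 → ℝ, c * (ξ ⬝ᵥ ξ) ≤ ξ ⬝ᵥ (ε x *ᵥ ξ) := ae_mono hν hell
  have hsq : ∀ x, 0 ≤ g x ⬝ᵥ g x := fun x => by
    simpa using dotProduct_star_self_nonneg (g x)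
  have hnn : ∀ᵐ x ∂ν, 0 ≤ ∑ i, d x * g x i * ∑ j, ε x i j * g x j := by
    filter_upwards [hell'] with x hx
    rw [hform]
    exact mul_nonneg (hd x) ((mul_nonneg hc.le (hsq x)).trans (hx _))
  have hz := (integral_eq_zero_iff_of_nonneg_ae hnn (integrable_finsetSum _ fun i _ => hint i)).1 h0
  filter_upwards [hz, hell'] with x hx hxe i
  have hx' : d x * (g x ⬝ᵥ (ε x *ᵥ g x)) = 0 := by rw [← hform]; exact hx
  rcases mul_eq_zero.1 hx' with h | h
  · rw [h, zero_mul]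
  · have h1 : g x ⬝ᵥ g x = 0 := by
      have := hxe (g x)
      rw [h] at this
      exact le_antisymm (by nlinarith) (hsq x)
    rw [dotProduct_self_eq_zero.1 h1]
    simp

/-- A sequence of bump functions shrinking to the origin. -/
noncomputable def shrinkingBump (n : ℕ) : ContDiffBump (0 : Space) where
  rIn := 1 / (2 * (n + 1))
  rOut := 1 / (n + 1)
  rIn_pos := by positivity
  rIn_lt_rOut := by
    have : (0 : ℝ) < n + 1 := by positivity
    exact one_div_lt_one_div_of_lt this (by linarith)

theorem tendsto_shrinkingBump_rOut : Tendsto (fun n => (shrinkingBump n).rOut) atTop (𝓝 0) :=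
  tendsto_one_div_add_atTop_nhds_zero_nat

theorem shrinkingBump_rOut_le_one (n : ℕ) : (shrinkingBump n).rOut ≤ 1 := by
  change 1 / ((n : ℝ) + 1) ≤ 1
  rw [div_le_one (by positivity)]
  linarith [n.cast_nonneg (α := ℝ)]

theorem ae_tendsto_mollify_shrinkingBump {f : Space → ℝ} (hf : LocallyIntegrable f volume) :
    ∀ᵐ x, Tendsto (fun n => mollify volume (shrinkingBump n) f x) atTop (𝓝 (f x)) :=
  ContDiffBump.ae_convolution_tendsto_right_of_locallyIntegrable (K := 2)
    tendsto_shrinkingBump_rOut (Eventually.of_forall fun n => by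
      change 1 / ((n : ℝ) + 1) ≤ 2 * (1 / (2 * (n + 1)))
      have : (n : ℝ) + 1 ≠ 0 := by positivity
      field_simp
      exact le_rfl) hf

/-- A weak solution of `∇·ε∇f = 0` that is at most `δ` near infinity is at most `δ` everywhere.
The test function is `F ∘ f` for a smooth substitute `F` of `t ↦ (t - δ)⁺`; mollifying `f` first
gives admissible test functions, all supported in one ball. -/
theorem ae_le_of_ae_le_near_infinity {ε : Space → Matrix (Fin 3) (Fin 3) ℝ}
    (hε : IsAdmissibleCoefficient ε) {f : Space → ℝ} {g : Space → Fin 3 → ℝ}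
    (h : MemH1LocWithGradient f g)
    (hweak : ∀ ψ : Space → ℝ, IsTestFunction ψ → gradientPairing ε ψ g = 0)
    {δ R : ℝ} (hR : ∀ᵐ x, R < ‖x‖ → f x ≤ δ) : ∀ᵐ x, f x ≤ δ := by
  obtain ⟨F, hF, hF0, hFd, hFd0, M, hM⟩ := exists_smooth_truncation δ
  have hFdc : Continuous (deriv F) := hF.continuous_deriv (by simp)
  have hf := h.memL2Loc.locallyIntegrable
  set K : Set Space := Metric.closedBall 0 (R + 1) with hKdef
  have hK : IsCompact K := isCompact_closedBall _ _
  set ν := (volume : Measure Space).restrict K with hν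
  set u : ℕ → Space → ℝ := fun n => mollify volume (shrinkingBump n) f with hu
  set a : Fin 3 → ℕ → Space → ℝ :=
    fun i n => mollify volume (shrinkingBump n) (fun y => g y i) with ha
  have hus : ∀ n, ContDiff ℝ ∞ (u n) := fun n => contDiff_mollify _ hf
  have hac : ∀ i n, Continuous (a i n) := fun i n =>
    (contDiff_mollify _ (h.gradient_memL2Loc i).locallyIntegrable).continuous
  -- the mollifications stay below `δ` outside the slightly larger ball `K`
  have hout : ∀ n, ∀ x ∉ K, u n x ≤ δ := by
    intro n x hx
    refine mollify_le_of_ball _ hf (hR.mono fun y hy hyx => hy ?_)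
    rw [hKdef, mem_closedBall_zero_iff, not_le] at hx
    have h1 := (Metric.mem_ball.1 hyx).trans_le (shrinkingBump_rOut_le_one n)
    rw [dist_comm, dist_eq_norm] at h1
    linarith [norm_sub_norm_le x y]
  have hsupp : ∀ n, Function.support (F ∘ u n) ⊆ K := fun n x hx => by
    by_contra hmem
    exact hx ((hF0 _).2 (hout n x hmem))
  have htest : ∀ n, IsTestFunction (F ∘ u n) := fun n =>
    ⟨hF.comp (hus n), HasCompactSupport.of_support_subset_isCompact hK (hsupp n)⟩
  have hpd : ∀ n i, partialDeriv i (F ∘ u n) = (deriv F ∘ u n) * a i n := by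
    intro n i
    funext x
    have h1 := (hF.differentiable (by simp) (u n x)).hasDerivAt.comp_hasFDerivAt x
      ((hus n).differentiable (by simp) x).hasFDerivAt
    rw [partialDeriv, h1.fderiv]
    have h2 := h.partialDeriv_mollify (shrinkingBump n) i x
    rw [partialDeriv] at h2
    simp only [Pi.mul_apply, Function.comp_apply, ha, ← h2]
    simp [hu]
  have hpd0 : ∀ n i, ∀ x ∉ K, partialDeriv i (F ∘ u n) x = 0 := fun n i x hx => by
    rw [hpd, Pi.mul_apply, Function.comp_apply, hFd0 _ (hout n x hx), zero_mul]
  have hutend : ∀ᵐ x, Tendsto (fun n => u n x) atTop (𝓝 (f x)) :=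
    ae_tendsto_mollify_shrinkingBump hf
  -- `∂ᵢ (F ∘ uₙ) → F'(f) gᵢ` in `L²(K)`
  have hgL : ∀ i, MemLp (fun x => g x i) 2 ν := fun i => h.gradient_memL2Loc i K hK
  have hdm : AEStronglyMeasurable (deriv F ∘ f) ν :=
    (hFdc.comp_aestronglyMeasurable hf.aestronglyMeasurable).restrict
  have hL2 : ∀ i, Tendsto (fun n => eLpNorm (partialDeriv i (F ∘ u n) -
      (deriv F ∘ f) * fun x => g x i) 2 ν) atTop (𝓝 0) := by
    intro i
    simp only [hpd]
    refine tendsto_eLpNorm_mul_sub (M := M)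
      (fun n => (hFdc.comp (hus n).continuous).aestronglyMeasurable) (fun n x => hM _) hdm
      (ae_restrict_of_ae (hutend.mono fun x hx => (hFdc.tendsto _).comp hx))
      (fun n => (hac i n).aestronglyMeasurable) (hgL i)
      (tendsto_eLpNorm_mollify_sub tendsto_shrinkingBump_rOut (h.gradient_memL2Loc i) hK)
  have hdg : ∀ i, MemLp ((deriv F ∘ f) * fun x => g x i) 2 ν := fun i =>
    memLp_smul_of_ae_bounded (hgL i) hdm (ae_of_all _ fun x => hM _)
  have hpL : ∀ i n, MemLp (partialDeriv i (F ∘ u n)) 2 ν := fun i n =>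
    (((htest n).continuous_partialDeriv i).memLp_of_hasCompactSupport
      ((htest n).hasCompactSupport_partialDeriv i)).restrict K
  have hV : ∀ i, MemLp (fun x => ∑ j, ε x i j * g x j) 2 ν := fun i =>
    memLp_finsetSum _ fun j _ => hε.memL2Loc_smul (h.gradient_memL2Loc j) i j K hK
  -- passing to the limit in the weak equation
  have henergy : ∑ i, ∫ x, deriv F (f x) * g x i * ∑ j, ε x i j * g x j ∂ν = 0 := by
    have hlim := tendsto_finsetSum Finset.univ fun i _ =>
      tendsto_integral_mul_of_tendsto_eLpNorm (hpL i) (hdg i) (hV i) (hL2 i)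
    refine tendsto_nhds_unique hlim (tendsto_const_nhds.congr fun n => ?_)
    have hswap : ∫ x, ∑ i, partialDeriv i (F ∘ u n) x * ∑ j, ε x i j * g x j ∂ν =
        ∑ i, ∫ x, partialDeriv i (F ∘ u n) x * ∑ j, ε x i j * g x j ∂ν :=
      integral_finsetSum _ fun i _ => (hpL i n).integrable_mul (hV i)
    rw [← hswap, ← hweak _ (htest n)]
    unfold gradientPairing
    simp only [smul_eq_mul, mul_assoc, ← Finset.mul_sum]
    refine (setIntegral_eq_integral_of_forall_compl_eq_zero fun x hx => ?_).symm
    simp [hpd0 n _ x hx]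
  have hzero := hε.ae_mul_eq_zero Measure.restrict_le_self (fun x => hFd (f x))
    (fun i => (hdg i).integrable_mul (hV i)) henergy
  -- hence `F ∘ uₙ → 0` in `L²`, by Poincaré's inequality
  have hgrad : ∀ i, Tendsto (fun n => eLpNorm (partialDeriv i (F ∘ u n)) 2 volume) atTop
      (𝓝 0) := by
    intro i
    refine (hL2 i).congr fun n => ?_
    have h1 : partialDeriv i (F ∘ u n) - ((deriv F ∘ f) * fun x => g x i) =ᵐ[ν]
        partialDeriv i (F ∘ u n) := by
      filter_upwards [hzero] with x hx
      simp [hx i]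
    rw [eLpNorm_congr_ae h1, hν, ← eLpNorm_indicator_eq_eLpNorm_restrict hK.measurableSet,
      Set.indicator_eq_self.2 fun x hx => by_contra fun hmem => hx (hpd0 n i x hmem)]
  have hnorm := tendsto_eLpNorm_of_tendsto_partialDeriv htest hK.isBounded hsupp hgrad
  have hle := Lp.eLpNorm_lim_le_liminf_eLpNorm (p := 2)
    (fun n => (htest n).smooth.continuous.aestronglyMeasurable (μ := (volume : Measure Space)))
    (F ∘ f) (hutend.mono fun x hx => (hF.continuous.tendsto _).comp hx)
  rw [hnorm.liminf_eq, nonpos_iff_eq_zero] at hle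
  have hFf : F ∘ f =ᵐ[volume] 0 := (eLpNorm_eq_zero_iff
    (hF.continuous.comp_aestronglyMeasurable hf.aestronglyMeasurable) (by norm_num)).1 hle
  exact hFf.mono fun x hx => (hF0 _).1 hx

theorem VanishesAtInfinity.ae_norm_le {𝕜 : Type*} [RCLike 𝕜] {f : Space → 𝕜}
    (hf : VanishesAtInfinity f) {δ : ℝ} (hδ : 0 < δ) : ∃ R : ℝ, ∀ᵐ x, R < ‖x‖ → ‖f x‖ ≤ δ := by
  have h1 : ∀ᶠ x in cocompact Space ⊓ ae volume, ‖f x‖ < δ := by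
    simpa using hf.eventually (Metric.ball_mem_nhds 0 hδ)
  obtain ⟨s, hs, t, ht, hst⟩ := Filter.mem_inf_iff_superset.1 h1
  rw [← Metric.cobounded_eq_cocompact] at hs
  obtain ⟨R, -, hR⟩ := (Metric.hasBasis_cobounded_compl_closedBall (0 : Space)).mem_iff.1 hs
  refine ⟨R, ?_⟩
  filter_upwards [ht] with x hx hxR
  exact (hst ⟨hR (by simpa using hxR), hx⟩ : ‖f x‖ < δ).le

/-- Uniqueness for the homogeneous problem: the maximum principle applies to `f` and `-f`. -/
theorem ae_eq_zero_of_gradientPairing_eq_zero {ε : Space → Matrix (Fin 3) (Fin 3) ℝ}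
    (hε : IsAdmissibleCoefficient ε) {f : Space → ℝ} {g : Space → Fin 3 → ℝ}
    (h : MemH1LocWithGradient f g)
    (hweak : ∀ ψ : Space → ℝ, IsTestFunction ψ → gradientPairing ε ψ g = 0)
    (hf : VanishesAtInfinity f) : f =ᵐ[volume] 0 := by
  have hneg : MemH1LocWithGradient (fun x => -f x) (fun x j => -g x j) :=
    h.clm_comp (-ContinuousLinearMap.id ℝ ℝ)
  have hwneg : ∀ ψ : Space → ℝ, IsTestFunction ψ →
      gradientPairing ε ψ (fun x j => -g x j) = 0 := fun ψ hψ => by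
    have := hε.gradientPairing_clm_comp (-ContinuousLinearMap.id ℝ ℝ) h.gradient_memL2Loc hψ
    rw [hweak ψ hψ, map_zero] at this
    exact this
  have hδ : ∀ n : ℕ, ∀ᵐ x, |f x| ≤ 1 / ((n : ℝ) + 1) := by
    intro n
    obtain ⟨R, hR⟩ := hf.ae_norm_le (δ := 1 / ((n : ℝ) + 1)) (by positivity)
    filter_upwards [ae_le_of_ae_le_near_infinity hε h hweak
        (hR.mono fun x hx hxR => (le_abs_self _).trans (hx hxR)),
      ae_le_of_ae_le_near_infinity hε hneg hwneg
        (hR.mono fun x hx hxR => (neg_le_abs _).trans (hx hxR))] with x h1 h2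
    exact abs_le.2 ⟨by linarith, h1⟩
  filter_upwards [ae_all_iff.2 hδ] with x hx
  exact abs_nonpos_iff.1 (ge_of_tendsto' tendsto_one_div_add_atTop_nhds_zero_nat hx)

end Electrostatic

theorem mainTheorem1 {𝕜 : Type*} [RCLike 𝕜]
    (ε : Electrostatic.Space → Matrix (Fin 3) (Fin 3) ℝ)
    (hε : Electrostatic.IsAdmissibleCoefficient ε)
    (φin : Electrostatic.Space → 𝕜) (hφin : Electrostatic.IsIncomingField ε φin)
    (φ₁ φ₂ : Electrostatic.Space → 𝕜)
    (h₁ : Electrostatic.IsScatteringSolution ε φin φ₁)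
    (h₂ : Electrostatic.IsScatteringSolution ε φin φ₂) :
    φ₁ =ᵐ[volume] φ₂ := by
  obtain ⟨⟨g₁, hg₁, hw₁⟩, hv₁⟩ := h₁
  obtain ⟨⟨g₂, hg₂, hw₂⟩, hv₂⟩ := h₂
  have hsub := hg₁.sub hg₂
  -- the right-hand sides cancel, so that real-linear functionals of `φ₁ - φ₂` solve the
  -- homogeneous equation
  have hzero : ∀ L : 𝕜 →L[ℝ] ℝ, (fun x => L (φ₁ x - φ₂ x)) =ᵐ[volume] 0 := by
    intro L
    refine Electrostatic.ae_eq_zero_of_gradientPairing_eq_zero hε (hsub.clm_comp L)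
      (fun ψ hψ => ?_) ?_
    · rw [hε.gradientPairing_clm_comp L hsub.gradient_memL2Loc hψ,
        hε.gradientPairing_sub hg₁.gradient_memL2Loc hg₂.gradient_memL2Loc hψ, hw₁ ψ hψ, hw₂ ψ hψ,
        sub_self, map_zero]
    · have h := (L.continuous.tendsto _).comp (hv₁.sub hv₂)
      rwa [sub_zero, map_zero] at h
  filter_upwards [hzero RCLike.reCLM, hzero RCLike.imCLM] with x hre him
  exact sub_eq_zero.1 (RCLike.ext (by simpa using hre) (by simpa using him))
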